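/- Let $\mathcal F$ be the class of functions $h$ analytic and locally univalent (i.e. $h'\neq 0$) in the unit disk $\mathbb D=\{z\in\mathbb C:|z|<1\}$ with $h(0)=0$, $h'(0)=1$ and $$\mathrm{Re}\Big(1+\frac{zh''(z)}{h'(z)}\Big)>-\frac12\qquad (z\in\mathbb D).$$ For $\beta>0$, $r\in(0,1)$ and $h\in\mathcal F$ put $$I_\beta(r,h)=\frac1{2\pi}\int_{-\pi}^{\pi}\frac{d\theta}{|h'(re^{i\theta})|^{2\beta}}.$$ Then for every $h\in\mathcal F$, $\beta>0$ and $r\in(0,1)$ the integral exists and $$I_\beta(r,h)\le \frac{2^{6\beta}}{\pi}\,B\Big(\frac{6\beta+1}{2},\frac12\Big),$$ where $B$ is the Euler beta function. The inequality is sharp: for every $\beta>0$ the right-hand side is the supremum of $I_\beta(r,h)$ over all $h\in\mathcal F$ and $r\in(0,1)$. It is approached by the function $$h_0(z)=\frac{z-z^2/2}{(1-z)^2},$$ which belongs to $\mathcal F$, is univalent in $\mathbb D$ and satisfies $h_0'(z)=(1-z)^{-3}$ for $z\in\mathbb D$: for every $\beta>0$, $$\lim_{r\to1^-}I_\beta(r,h_0)=\frac{2^{6\beta}}{\pi}\,B\Big(\frac{6\beta+1}{2},\frac12\Big).$$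 -/

import Mathlib

open Filter Topology

/-- The class `𝒜`: functions `h` analytic in the open unit disk, with `h 0 = 0` and `h' 0 = 1`.
Only the values of `h` in the disk matter. -/
def classA : Set (ℂ → ℂ) :=
  {h | AnalyticOnNhd ℂ h (Metric.ball 0 1) ∧ h 0 = 0 ∧ deriv h 0 = 1}

/-- The class `𝒮`: functions of the class `𝒜` that are univalent (injective) in the unit disk. -/
def classS : Set (ℂ → ℂ) :=
  {h | h ∈ classA ∧ Set.InjOn h (Metric.ball 0 1)}

/-- The class `𝒦(α)`: locally univalent functions `h` of the class `𝒜` (that is, `h'` has no zero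
in the unit disk) with `Re (1 + z h''(z) / h'(z)) > α` in the unit disk. -/
def classK (α : ℝ) : Set (ℂ → ℂ) :=
  {h | h ∈ classA ∧ ∀ z ∈ Metric.ball (0 : ℂ) 1,
    deriv h z ≠ 0 ∧ α < (1 + z * deriv (deriv h) z / deriv h z).re}

/-- The class `ℱ = 𝒦(-1/2)`. -/
def classF : Set (ℂ → ℂ) := classK (-1 / 2)

/-- The integrand `θ ↦ 1 / |h'(r e^{iθ})|^{2β}`. -/
noncomputable def meanIntegrand (β r : ℝ) (h : ℂ → ℂ) (θ : ℝ) : ℝ :=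
  1 / ‖deriv h (r * Complex.exp (θ * Complex.I))‖ ^ (2 * β)

/-- The integral mean `I_β(r, h) = (1 / 2π) ∫_{-π}^{π} dθ / |h'(r e^{iθ})|^{2β}`. -/
noncomputable def integralMean (β r : ℝ) (h : ℂ → ℂ) : ℝ :=
  1 / (2 * Real.pi) * ∫ θ in (-Real.pi)..Real.pi, meanIntegrand β r h θ

/-- The constant `(2^{6β} / π) B((6β + 1) / 2, 1 / 2)`, where `B` is the Euler beta function. -/
noncomputable def sharpConst (β : ℝ) : ℝ :=
  (2 : ℝ) ^ (6 * β) / Real.pi * ProbabilityTheory.beta ((6 * β + 1) / 2) (1 / 2)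

/-- The function `h₀(z) = (z - z² / 2) / (1 - z)²`. -/
noncomputable def extremalFun (z : ℂ) : ℂ := (z - z ^ 2 / 2) / (1 - z) ^ 2

/-! The defining condition of the class says that `1 + (2/3) z h''/h'` has positive real part ρ, and
its value at 0 is 1. So on every circle of radius `R < 1`, ρ is a probability density. The Poisson
formula, integrated along the ray from 0 to `z`, gives `log |h'(z)| = -3 · avg ρ(w) log |1 - z/w|`
over `|w| = R` (`log_norm_deriv_eq_circleAverage`).

Multiply by `-2β` and apply Jensen's inequality for `exp`: `|h'(z)|^(-2β)` is at most the ρ-average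
of `|1 - z/w|^(6β)` (`one_div_norm_deriv_rpow_le`). Average over `|z| = r` and exchange the two
averages. Since `|1 - ζ|^(6β)` is subharmonic, each inner mean, taken over a circle of radius `r/R <
1`, is at most the mean over the unit circle (`circleAverage_norm_one_sub_mul_rpow_le`), which is
the beta constant (`circleAverage_norm_one_sub_rpow`). Total mass 1 of ρ finishes the bound.

For `h₀` the integrand is exactly `|1 - z|^(6β)`, so its means tend to the constant as `r → 1`,
which gives sharpness. -/

/-! ### Fubini, Jensen and logarithmic derivatives. -/

theorem circleAverage_circleAverage_swap {F : ℂ → ℂ → ℝ} {r R : ℝ}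
    (hF : ContinuousOn (Function.uncurry F) (Metric.sphere 0 |r| ×ˢ Metric.sphere 0 |R|)) :
    Real.circleAverage (fun z => Real.circleAverage (F z) 0 R) 0 r =
      Real.circleAverage (fun w => Real.circleAverage (fun z => F z w) 0 r) 0 R := by
  have hc : Continuous (Function.uncurry fun s t : ℝ => F (circleMap 0 r s) (circleMap 0 R t)) := by
    have : Continuous fun p : ℝ × ℝ => (circleMap 0 r p.1, circleMap 0 R p.2) := by fun_prop
    exact hF.comp_continuous this fun p =>
      ⟨circleMap_mem_sphere' 0 r p.1, circleMap_mem_sphere' 0 R p.2⟩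
  simp only [Real.circleAverage, intervalIntegral.integral_smul]
  rw [smul_comm]
  congr 2
  simp only [intervalIntegral.integral_of_le Real.two_pi_pos.le]
  refine MeasureTheory.integral_integral_swap ?_
  rw [MeasureTheory.Measure.prod_restrict]
  exact (hc.continuousOn.integrableOn_compact
    (isCompact_Icc.prod isCompact_Icc)).mono_set
      (Set.prod_mono Set.Ioc_subset_Icc_self Set.Ioc_subset_Icc_self)

theorem circleIntegrable_circleAverage {F : ℂ → ℂ → ℝ} {r R : ℝ}
    (hF : ContinuousOn (Function.uncurry F) (Metric.sphere 0 |r| ×ˢ Metric.sphere 0 |R|)) :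
    CircleIntegrable (fun z => Real.circleAverage (F z) 0 R) 0 r := by
  have hc : Continuous (Function.uncurry fun s t : ℝ => F (circleMap 0 r s) (circleMap 0 R t)) := by
    have : Continuous fun p : ℝ × ℝ => (circleMap 0 r p.1, circleMap 0 R p.2) := by fun_prop
    exact hF.comp_continuous this fun p =>
      ⟨circleMap_mem_sphere' 0 r p.1, circleMap_mem_sphere' 0 R p.2⟩
  exact ((intervalIntegral.continuous_parametric_intervalIntegral_of_continuous' hc 0
    (2 * Real.pi)).const_smul (2 * Real.pi)⁻¹).intervalIntegrable _ _

theorem circleAverage_intervalIntegral_swap {F : ℂ → ℝ → ℝ} {R a b : ℝ} (hab : a ≤ b)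
    (hF : ContinuousOn (Function.uncurry F) (Metric.sphere 0 |R| ×ˢ Set.Icc a b)) :
    Real.circleAverage (fun z => ∫ t in a..b, F z t) 0 R =
      ∫ t in a..b, Real.circleAverage (fun z => F z t) 0 R := by
  have hc : ContinuousOn (Function.uncurry fun s t : ℝ => F (circleMap 0 R s) t)
      (Set.Icc 0 (2 * Real.pi) ×ˢ Set.Icc a b) := by
    have : Continuous fun p : ℝ × ℝ => (circleMap 0 R p.1, p.2) := by fun_prop
    exact hF.comp this.continuousOn fun p hp => ⟨circleMap_mem_sphere' 0 R p.1, hp.2⟩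
  simp only [Real.circleAverage, intervalIntegral.integral_smul]
  congr 1
  simp only [intervalIntegral.integral_of_le Real.two_pi_pos.le,
    intervalIntegral.integral_of_le hab]
  refine MeasureTheory.integral_integral_swap ?_
  rw [MeasureTheory.Measure.prod_restrict]
  exact (hc.integrableOn_compact (isCompact_Icc.prod isCompact_Icc)).mono_set
      (Set.prod_mono Set.Ioc_subset_Icc_self Set.Ioc_subset_Icc_self)

/-- Jensen's inequality for the exponential function and a weighted circle average. -/
theorem exp_circleAverage_mul_le {ρ g : ℂ → ℝ} {R : ℝ}
    (hρ : ContinuousOn ρ (Metric.sphere 0 |R|)) (hg : ContinuousOn g (Metric.sphere 0 |R|))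
    (hρ0 : ∀ z ∈ Metric.sphere (0 : ℂ) |R|, 0 ≤ ρ z) (hρ1 : Real.circleAverage ρ 0 R = 1) :
    Real.exp (Real.circleAverage (fun z => ρ z * g z) 0 R) ≤
      Real.circleAverage (fun z => ρ z * Real.exp (g z)) 0 R := by
  set m := Real.circleAverage (fun z => ρ z * g z) 0 R with hm
  -- The tangent line of `exp` at `m`, composed with `g` and averaged against ρ, gives exactly `exp
  -- m`; convexity puts `exp` above this line.
  have h1 : Real.circleAverage
      (fun z => (Real.exp m * (1 - m)) • ρ z + Real.exp m • (ρ z * g z)) 0 R = Real.exp m := by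
    rw [Real.circleAverage_fun_add (ContinuousOn.circleIntegrable' (by fun_prop))
      (ContinuousOn.circleIntegrable' (by fun_prop)), Real.circleAverage_fun_smul,
      Real.circleAverage_fun_smul, hρ1, ← hm, smul_eq_mul, smul_eq_mul]
    ring
  rw [← h1]
  refine Real.circleAverage_mono (ContinuousOn.circleIntegrable' (by fun_prop))
    (ContinuousOn.circleIntegrable' (by fun_prop)) fun z hz => ?_
  have h2 : Real.exp m * (g z - m + 1) ≤ Real.exp (g z) := by
    calc Real.exp m * (g z - m + 1) ≤ Real.exp m * Real.exp (g z - m) := by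
          gcongr; exact Real.add_one_le_exp _
      _ = Real.exp (g z) := by rw [← Real.exp_add]; ring_nf
  have := mul_le_mul_of_nonneg_left h2 (hρ0 z hz)
  simp only [smul_eq_mul]
  linarith

/-- `Re (f'/f)` is the derivative of `log ‖f‖ = log (‖f‖²) / 2`, so no branch of the complex
logarithm is needed. -/
theorem integral_re_div_eq_log_norm_sub {f f' : ℝ → ℂ} {a b : ℝ} (hab : a ≤ b)
    (hf : ∀ t ∈ Set.Icc a b, HasDerivAt f (f' t) t) (h0 : ∀ t ∈ Set.Icc a b, f t ≠ 0)
    (hf' : ContinuousOn f' (Set.Icc a b)) :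
    ∫ t in a..b, (f' t / f t).re = Real.log ‖f b‖ - Real.log ‖f a‖ := by
  have hc : ContinuousOn f (Set.Icc a b) := fun t ht => (hf t ht).continuousAt.continuousWithinAt
  rw [← Set.uIcc_of_le hab] at hf h0 hf' hc
  refine intervalIntegral.integral_eq_sub_of_hasDerivAt
    (f := fun t => Real.log ‖f t‖) (fun t ht => ?_) (ContinuousOn.intervalIntegrable ?_)
  · have h1 := ((hf t ht).norm_sq.log (by simpa using h0 t ht)).div_const 2
    have h2 : (fun t => Real.log (‖f t‖ ^ 2) / 2) = fun t => Real.log ‖f t‖ := by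
      ext t; rw [Real.log_pow]; push_cast; ring
    rw [h2] at h1
    refine h1.congr_deriv ?_
    rw [Complex.div_re, Complex.normSq_eq_norm_sq, Complex.inner]
    simp
    ring
  · exact Complex.continuous_re.comp_continuousOn (hf'.div hc h0)

theorem norm_circleAverage_le_circleAverage_norm {f : ℂ → ℂ} {c : ℂ} {R : ℝ} :
    ‖Real.circleAverage f c R‖ ≤ Real.circleAverage (fun z => ‖f z‖) c R := by
  rw [Real.circleAverage, Real.circleAverage, norm_smul, smul_eq_mul, Real.norm_eq_abs,
    abs_of_pos (inv_pos.2 Real.two_pi_pos)]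
  gcongr
  exact intervalIntegral.norm_integral_le_integral_norm Real.two_pi_pos.le

/-! ### Subharmonicity of `|1 - z|^p`. -/

theorem re_herglotzRieszKernel_nonneg {R : ℝ} {w z : ℂ} (hw : ‖w‖ < R)
    (hz : z ∈ Metric.sphere (0 : ℂ) R) : 0 ≤ (herglotzRieszKernel 0 w z).re := by
  have h := le_re_herglotzRieszKernel hz (w := w) (by simpa using hw)
  simp only [sub_zero] at h
  simp only [herglotzRieszKernel_def, sub_zero]
  refine le_trans ?_ h
  have := norm_nonneg w
  exact div_nonneg (by linarith) (by linarith)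

/-- The principal branch of `(1 - z)^p` is holomorphic in the disk and, because `p > 0`, continuous
up to the boundary point 1. Take norms in its Poisson formula; the kernel is nonnegative. -/
theorem norm_one_sub_rpow_le_circleAverage {p : ℝ} (hp : 0 < p) {w : ℂ} (hw : ‖w‖ < 1) :
    ‖1 - w‖ ^ p ≤
      Real.circleAverage (fun z => (herglotzRieszKernel 0 w z).re * ‖1 - z‖ ^ p) 0 1 := by
  have hd : DiffContOnCl ℂ (fun z : ℂ => (1 - z) ^ (p : ℂ)) (Metric.ball 0 1) := by
    have hs : ∀ z : ℂ, ‖z‖ ≤ 1 → z ≠ 1 → 1 - z ∈ Complex.slitPlane := by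
      intro z hz hz1
      refine Or.inl ?_
      have h1 : z.re ≤ 1 := (Complex.re_le_norm z).trans hz
      have h2 : z.re ≠ 1 := by
        intro h
        apply hz1
        have h3 := Complex.sq_norm z
        rw [Complex.normSq_apply, h] at h3
        have h4 : z.im = 0 := by nlinarith [norm_nonneg z, mul_self_nonneg z.im]
        exact Complex.ext h h4
      simpa using lt_of_le_of_ne h1 h2
    refine ⟨fun z hz => ?_, fun z hz => ?_⟩
    · have hz' : ‖z‖ < 1 := by simpa using hz
      have hne : z ≠ 1 := by rintro rfl; simp at hz'
      exact ((differentiableAt_id.const_sub 1).cpow_const (hs z hz'.le hne)).differentiableWithinAt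
    · rw [closure_ball _ one_ne_zero] at hz
      have hz' : ‖z‖ ≤ 1 := by simpa using hz
      refine ContinuousAt.continuousWithinAt ?_
      by_cases hne : z = 1
      · have h0 := Complex.continuousAt_cpow_const_of_re_pos (z := 1 - z) (w := (p : ℂ))
          (by simp [hne]) (by simpa using hp)
        exact h0.comp (f := fun z : ℂ => 1 - z) (by fun_prop)
      · exact ContinuousAt.cpow (by fun_prop) continuousAt_const (hs z hz' hne)
  have h := hd.circleAverage_re_herglotzRieszKernel_smul (w := w) (by simpa using hw)
  have h2 := norm_circleAverage_le_circleAverage_norm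
    (f := (Complex.re ∘ herglotzRieszKernel 0 w) • fun z : ℂ => (1 - z) ^ (p : ℂ)) (c := 0) (R := 1)
  rw [h, Complex.norm_cpow_real] at h2
  refine h2.trans_eq (Real.circleAverage_congr_sphere fun z hz => ?_)
  rw [abs_one] at hz
  simp [abs_of_nonneg (re_herglotzRieszKernel_nonneg hw hz), Complex.norm_cpow_real]

/-- Average the Poisson bound at the point `a * z` over `|z| = 1` and exchange. For fixed `w` the
kernel is holomorphic in `z`, so its mean is its value 1 at `z = 0`. -/
theorem circleAverage_norm_one_sub_mul_rpow_le {p : ℝ} (hp : 0 < p) {a : ℂ} (ha : ‖a‖ < 1) :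
    Real.circleAverage (fun z => ‖1 - a * z‖ ^ p) 0 1 ≤
      Real.circleAverage (fun z => ‖1 - z‖ ^ p) 0 1 := by
  have hr : ∀ x : ℂ, Continuous fun z : ℂ => ‖1 - x * z‖ ^ p := fun x =>
    Continuous.rpow_const (by fun_prop) fun _ => Or.inr hp.le
  have hr1 : Continuous fun z : ℂ => ‖1 - z‖ ^ p := by simpa using hr 1
  have hne : ∀ z w : ℂ, ‖z‖ ≤ 1 → ‖w‖ = 1 → w - a * z ≠ 0 := by
    intro z w hz hw h
    have h1 : ‖w‖ = ‖a‖ * ‖z‖ := by rw [sub_eq_zero.1 h, norm_mul]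
    nlinarith [norm_nonneg a, norm_nonneg z]
  have hK : ContinuousOn (Function.uncurry fun z w : ℂ => (herglotzRieszKernel 0 (a * z) w).re)
      (Metric.sphere 0 |1| ×ˢ Metric.sphere 0 |1|) := by
    refine Complex.continuous_re.comp_continuousOn ?_
    simp only [herglotzRieszKernel_def, sub_zero]
    refine ContinuousOn.div (by fun_prop) (by fun_prop) fun x hx => ?_
    have h1 : ‖x.1‖ = 1 := by simpa using hx.1
    exact hne x.1 x.2 h1.le (by simpa using hx.2)
  have hF : ContinuousOn (Function.uncurry fun z w : ℂ =>
      (herglotzRieszKernel 0 (a * z) w).re * ‖1 - w‖ ^ p)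
      (Metric.sphere 0 |1| ×ˢ Metric.sphere 0 |1|) :=
    hK.mul (hr1.comp continuous_snd).continuousOn
  have hmean : ∀ w ∈ Metric.sphere (0 : ℂ) |1|,
      Real.circleAverage (fun z => (herglotzRieszKernel 0 (a * z) w).re * ‖1 - w‖ ^ p) 0 1 =
        ‖1 - w‖ ^ p := by
    intro w hw
    have hw1 : ‖w‖ = 1 := by simpa using hw
    have hw0 : w ≠ 0 := by rintro rfl; simp at hw1
    have hd : DiffContOnCl ℂ (fun z => herglotzRieszKernel 0 (a * z) w) (Metric.ball 0 |1|) := by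
      rw [abs_one]
      refine DifferentiableOn.diffContOnCl ?_
      rw [closure_ball _ one_ne_zero]
      intro z hz
      simp only [herglotzRieszKernel_def, sub_zero]
      have : DifferentiableAt ℂ (fun z => (w + a * z) / (w - a * z)) z :=
        DifferentiableAt.div (by fun_prop) (by fun_prop) (hne z w (by simpa using hz) hw1)
      exact this.differentiableWithinAt
    have h1 := hd.circleAverage
    have h2 := Complex.reCLM.circleAverage_comp_comm
      (f := fun z => herglotzRieszKernel 0 (a * z) w) (c := 0) (R := 1)
      (ContinuousOn.circleIntegrable' (hd.2.mono (by
        rw [abs_one, closure_ball _ one_ne_zero]; exact Metric.sphere_subset_closedBall)))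
    rw [h1] at h2
    have h3 := Real.circleAverage_fun_smul (a := ‖1 - w‖ ^ p)
      (f := fun z => (herglotzRieszKernel 0 (a * z) w).re) (c := 0) (R := 1)
    have h4 : Real.circleAverage (fun z => (herglotzRieszKernel 0 (a * z) w).re) 0 1 = 1 := by
      refine h2.trans ?_
      simp [herglotzRieszKernel_def, hw0]
    rw [h4, smul_eq_mul, mul_one] at h3
    simpa only [smul_eq_mul, mul_comm] using h3
  calc Real.circleAverage (fun z => ‖1 - a * z‖ ^ p) 0 1
      ≤ Real.circleAverage (fun z => Real.circleAverage
          (fun w => (herglotzRieszKernel 0 (a * z) w).re * ‖1 - w‖ ^ p) 0 1) 0 1 := by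
        refine Real.circleAverage_mono (hr a).continuousOn.circleIntegrable'
          (circleIntegrable_circleAverage hF) fun z hz => ?_
        refine norm_one_sub_rpow_le_circleAverage hp ?_
        have : ‖z‖ = 1 := by simpa using hz
        simpa [this] using ha
    _ = Real.circleAverage (fun z => ‖1 - z‖ ^ p) 0 1 := by
        rw [circleAverage_circleAverage_swap hF]
        exact Real.circleAverage_congr_sphere hmean

/-! ### The beta constant as a mean over the unit circle. -/

/-- Substitute `x = sin² (θ/2)` in the beta integral. -/
theorem beta_half_eq_integral_sin_rpow {p : ℝ} (hp : 0 < p) :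
    ProbabilityTheory.beta ((p + 1) / 2) (1 / 2) =
      ∫ θ in (0 : ℝ)..Real.pi, Real.sin (θ / 2) ^ p := by
  have h1 : ProbabilityTheory.beta ((p + 1) / 2) (1 / 2) =
      ∫ x in Set.Ioo (0 : ℝ) 1, x ^ ((p + 1) / 2 - 1) * (1 - x) ^ ((1 : ℝ) / 2 - 1) := by
    rw [ProbabilityTheory.beta_eq_betaIntegralReal _ _ (by positivity) (by norm_num),
      Complex.betaIntegral, intervalIntegral.integral_of_le zero_le_one,
      MeasureTheory.integral_Ioc_eq_integral_Ioo]
    rw [← Complex.ofReal_re (∫ x in Set.Ioo (0 : ℝ) 1, _), ← integral_complex_ofReal]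
    congr 1
    refine MeasureTheory.setIntegral_congr_fun measurableSet_Ioo fun x hx => ?_
    have hx1 : 0 ≤ 1 - x := by linarith [hx.2]
    rw [Complex.ofReal_mul, Complex.ofReal_cpow hx.1.le, Complex.ofReal_cpow hx1]
    push_cast
    rfl
  have himg : (fun θ : ℝ => Real.sin (θ / 2) ^ 2) '' Set.Ioo 0 Real.pi = Set.Ioo 0 1 := by
    ext x
    constructor
    · rintro ⟨θ, hθ, rfl⟩
      have h2 : 0 < Real.sin (θ / 2) :=
        Real.sin_pos_of_pos_of_lt_pi (by linarith [hθ.1]) (by linarith [hθ.1, hθ.2])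
      have h3 : 0 < Real.cos (θ / 2) :=
        Real.cos_pos_of_mem_Ioo ⟨by linarith [hθ.1, Real.pi_pos], by linarith [hθ.2]⟩
      have := Real.sin_sq_add_cos_sq (θ / 2)
      exact ⟨by positivity, by nlinarith⟩
    · rintro ⟨hx0, hx1⟩
      have hs0 : 0 < √x := Real.sqrt_pos.2 hx0
      have hs1 : √x < 1 := by rw [Real.sqrt_lt' one_pos]; simpa using hx1
      refine ⟨2 * Real.arcsin √x, ⟨?_, ?_⟩, ?_⟩
      · linarith [Real.arcsin_pos.2 hs0]
      · linarith [Real.arcsin_lt_pi_div_two.2 hs1]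
      · simp only [mul_div_cancel_left₀ _ (two_ne_zero' ℝ)]
        rw [Real.sin_arcsin (by linarith) hs1.le, Real.sq_sqrt hx0.le]
  have hinj : Set.InjOn (fun θ : ℝ => Real.sin (θ / 2) ^ 2) (Set.Ioo 0 Real.pi) := by
    intro a ha b hb hab
    have h2 : ∀ θ ∈ Set.Ioo 0 Real.pi, 0 ≤ Real.sin (θ / 2) := fun θ hθ =>
      Real.sin_nonneg_of_nonneg_of_le_pi (by linarith [hθ.1]) (by linarith [hθ.1, hθ.2])
    have h3 := (sq_eq_sq₀ (h2 a ha) (h2 b hb)).1 hab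
    have h4 := Real.injOn_sin ⟨by linarith [ha.1, Real.pi_pos], by linarith [ha.2]⟩
      ⟨by linarith [hb.1, Real.pi_pos], by linarith [hb.2]⟩ h3
    linarith
  rw [h1, ← himg, MeasureTheory.integral_image_eq_integral_abs_deriv_smul measurableSet_Ioo
    (f' := fun θ => Real.sin (θ / 2) * Real.cos (θ / 2)) (fun θ _ => ?_) hinj,
    intervalIntegral.integral_of_le Real.pi_pos.le, MeasureTheory.integral_Ioc_eq_integral_Ioo]
  · refine MeasureTheory.setIntegral_congr_fun measurableSet_Ioo fun θ hθ => ?_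
    have h2 : 0 < Real.sin (θ / 2) :=
      Real.sin_pos_of_pos_of_lt_pi (by linarith [hθ.1]) (by linarith [hθ.1, hθ.2])
    have h3 : 0 < Real.cos (θ / 2) :=
      Real.cos_pos_of_mem_Ioo ⟨by linarith [hθ.1, Real.pi_pos], by linarith [hθ.2]⟩
    have h4 : 1 - Real.sin (θ / 2) ^ 2 = Real.cos (θ / 2) ^ 2 := by
      linarith [Real.sin_sq_add_cos_sq (θ / 2)]
    simp only [smul_eq_mul]
    rw [h4, ← Real.rpow_natCast_mul h2.le, ← Real.rpow_natCast_mul h3.le, abs_of_pos (by positivity)]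
    have e1 : ((2 : ℕ) : ℝ) * ((p + 1) / 2 - 1) = p - 1 := by push_cast; ring
    have e2 : ((2 : ℕ) : ℝ) * (1 / 2 - 1) = -1 := by norm_num
    rw [e1, e2, Real.rpow_neg_one, Real.rpow_sub_one h2.ne']
    field_simp
  · refine HasDerivAt.hasDerivWithinAt ?_
    refine (((hasDerivAt_id θ).div_const 2).sin.pow 2).congr_deriv ?_
    simp
    ring

theorem norm_one_sub_circleMap (θ : ℝ) : ‖1 - circleMap 0 1 θ‖ = 2 * |Real.sin (θ / 2)| := by
  have h : ‖1 - circleMap 0 1 θ‖ ^ 2 = (2 * |Real.sin (θ / 2)|) ^ 2 := by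
    rw [mul_pow, sq_abs, Complex.sq_norm, Complex.normSq_apply, circleMap_zero, Complex.exp_mul_I,
      ← Complex.ofReal_cos, ← Complex.ofReal_sin]
    have h1 := Real.cos_sq (θ / 2)
    rw [mul_div_cancel₀ θ (two_ne_zero' ℝ)] at h1
    have h2 := Real.sin_sq_add_cos_sq (θ / 2)
    have h3 := Real.sin_sq_add_cos_sq θ
    simp [-Complex.ofReal_cos, -Complex.ofReal_sin]
    nlinarith
  exact (sq_eq_sq₀ (norm_nonneg _) (by positivity)).1 h

theorem circleAverage_eq_integral_neg_pi_pi (f : ℂ → ℝ) (r : ℝ) :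
    Real.circleAverage f 0 r =
      1 / (2 * Real.pi) * ∫ θ in (-Real.pi)..Real.pi, f (r * Complex.exp (θ * Complex.I)) := by
  have t₀ : (fun θ ↦ f (circleMap 0 r θ)).Periodic (2 * Real.pi) :=
    fun x ↦ by simp [periodic_circleMap 0 r x]
  have h := t₀.intervalIntegral_add_eq 0 (-Real.pi)
  rw [zero_add, show -Real.pi + 2 * Real.pi = Real.pi by ring] at h
  rw [Real.circleAverage, h, smul_eq_mul, one_div]
  simp only [circleMap_zero]

theorem circleAverage_norm_one_sub_rpow {β : ℝ} (hβ : 0 < β) :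
    Real.circleAverage (fun z => ‖1 - z‖ ^ (6 * β)) 0 1 = sharpConst β := by
  have hp : 0 < 6 * β := by positivity
  have hc : Continuous fun θ : ℝ => (2 * |Real.sin (θ / 2)|) ^ (6 * β) :=
    Continuous.rpow_const (by fun_prop) fun _ => Or.inr hp.le
  have h0 : ∫ θ in (0 : ℝ)..Real.pi, (2 * |Real.sin (θ / 2)|) ^ (6 * β) =
      2 ^ (6 * β) * ProbabilityTheory.beta ((6 * β + 1) / 2) (1 / 2) := by
    rw [beta_half_eq_integral_sin_rpow hp, ← intervalIntegral.integral_const_mul]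
    refine intervalIntegral.integral_congr fun θ hθ => ?_
    rw [Set.uIcc_of_le Real.pi_pos.le] at hθ
    have h2 : 0 ≤ Real.sin (θ / 2) :=
      Real.sin_nonneg_of_nonneg_of_le_pi (by linarith [hθ.1]) (by linarith [hθ.1, hθ.2])
    simp only [abs_of_nonneg h2]
    rw [Real.mul_rpow zero_le_two h2]
  have h1 : ∫ θ in (-Real.pi)..0, (2 * |Real.sin (θ / 2)|) ^ (6 * β) =
      ∫ θ in (0 : ℝ)..Real.pi, (2 * |Real.sin (θ / 2)|) ^ (6 * β) := by
    have := intervalIntegral.integral_comp_neg (a := 0) (b := Real.pi)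
      (fun θ => (2 * |Real.sin (θ / 2)|) ^ (6 * β))
    rw [neg_zero] at this
    rw [← this]
    simp [neg_div]
  rw [circleAverage_eq_integral_neg_pi_pi]
  have h2 : ∀ θ : ℝ, ((1 : ℝ) : ℂ) * Complex.exp (θ * Complex.I) = circleMap 0 1 θ := fun θ => by
    rw [circleMap_zero]
  simp only [h2, norm_one_sub_circleMap]
  rw [← intervalIntegral.integral_add_adjacent_intervals (hc.intervalIntegrable _ 0)
    (hc.intervalIntegrable 0 _), h1, h0, sharpConst]
  field_simp
  ring

/-! ### The extremal function. -/

theorem one_sub_ne_zero_of_mem_ball {z : ℂ} (hz : z ∈ Metric.ball (0 : ℂ) 1) : 1 - z ≠ 0 := by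
  intro h
  rw [← sub_eq_zero.1 h] at hz
  simp at hz

theorem hasDerivAt_extremalFun {z : ℂ} (hz : 1 - z ≠ 0) :
    HasDerivAt extremalFun (1 / (1 - z) ^ 3) z := by
  have h := ((hasDerivAt_id z).sub (((hasDerivAt_id z).pow 2).div_const 2)).div
    (((hasDerivAt_id z).const_sub 1).pow 2) (pow_ne_zero 2 hz)
  refine h.congr_deriv ?_
  simp only [id, Pi.pow_apply, Pi.sub_apply]
  field_simp
  ring

theorem deriv_extremalFun {z : ℂ} (hz : z ∈ Metric.ball (0 : ℂ) 1) :
    deriv extremalFun z = 1 / (1 - z) ^ 3 :=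
  (hasDerivAt_extremalFun (one_sub_ne_zero_of_mem_ball hz)).deriv

theorem deriv_deriv_extremalFun {z : ℂ} (hz : z ∈ Metric.ball (0 : ℂ) 1) :
    deriv (deriv extremalFun) z = 3 / (1 - z) ^ 4 := by
  have hev : deriv extremalFun =ᶠ[𝓝 z] fun w => ((1 - w) ^ 3)⁻¹ := by
    filter_upwards [Metric.isOpen_ball.mem_nhds hz] with w hw
    rw [deriv_extremalFun hw, one_div]
  have hne := one_sub_ne_zero_of_mem_ball hz
  rw [hev.deriv_eq]
  refine HasDerivAt.deriv ?_
  refine ((((hasDerivAt_id z).const_sub 1).pow 3).fun_inv (pow_ne_zero 3 hne)).congr_deriv ?_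
  simp only [id, Pi.pow_apply]
  field_simp
  push_cast
  ring

theorem extremalFun_mem_classA : extremalFun ∈ classA := by
  refine ⟨DifferentiableOn.analyticOnNhd (fun z hz => (hasDerivAt_extremalFun
    (one_sub_ne_zero_of_mem_ball hz)).differentiableAt.differentiableWithinAt)
    Metric.isOpen_ball, by simp [extremalFun], ?_⟩
  rw [deriv_extremalFun (by simp)]
  simp

theorem extremalFun_mem_classF : extremalFun ∈ classF := by
  refine ⟨extremalFun_mem_classA, fun z hz => ?_⟩
  have hne := one_sub_ne_zero_of_mem_ball hz
  rw [deriv_deriv_extremalFun hz, deriv_extremalFun hz]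
  refine ⟨div_ne_zero one_ne_zero (pow_ne_zero 3 hne), ?_⟩
  -- `(1 + z) / (1 - z)` maps the disk into the right half-plane.
  have h1 : 1 + z * (3 / (1 - z) ^ 4) / (1 / (1 - z) ^ 3) = -1 / 2 + 3 / 2 * ((1 + z) / (1 - z)) := by
    field_simp
    ring
  have hz1 : ‖z‖ < 1 := by simpa using hz
  have h2 : 0 < ((1 + z) / (1 - z)).re := by
    rw [Complex.div_re, ← add_div]
    refine div_pos ?_ (Complex.normSq_pos.2 hne)
    have h3 := Complex.sq_norm z
    rw [Complex.normSq_apply] at h3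
    simp
    nlinarith [norm_nonneg z]
  have h4 : (-1 / 2 + 3 / 2 * ((1 + z) / (1 - z)) : ℂ) =
      ((-1 / 2 : ℝ) : ℂ) + ((3 / 2 : ℝ) : ℂ) * ((1 + z) / (1 - z)) := by push_cast; ring
  rw [h1, h4, Complex.add_re, Complex.re_ofReal_mul, Complex.ofReal_re]
  linarith

theorem extremalFun_mem_classS : extremalFun ∈ classS := by
  refine ⟨extremalFun_mem_classA, fun z hz w hw h => ?_⟩
  have hz0 := one_sub_ne_zero_of_mem_ball hz
  have hw0 := one_sub_ne_zero_of_mem_ball hw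
  -- As `h₀(z) = ((1 - z)⁻² - 1) / 2`, equal values give `(1 - z)² = (1 - w)²`; the second factor
  -- has positive real part.
  have h1 : (1 - z - (1 - w)) * (1 - z + (1 - w)) = 0 := by
    simp only [extremalFun] at h
    rw [div_eq_div_iff (pow_ne_zero 2 hz0) (pow_ne_zero 2 hw0)] at h
    linear_combination -2 * h
  rcases mul_eq_zero.1 h1 with h2 | h2
  · linear_combination -h2
  · have h3 := congrArg Complex.re h2
    have h4 := (Complex.re_le_norm z).trans_lt (by simpa using hz)
    have h5 := (Complex.re_le_norm w).trans_lt (by simpa using hw)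
    simp at h3
    linarith

theorem integralMean_eq_circleAverage (β r : ℝ) (h : ℂ → ℂ) :
    integralMean β r h = Real.circleAverage (fun z => 1 / ‖deriv h z‖ ^ (2 * β)) 0 r :=
  (circleAverage_eq_integral_neg_pi_pi (fun z => 1 / ‖deriv h z‖ ^ (2 * β)) r).symm

theorem integralMean_extremalFun {β r : ℝ} (hr : r ∈ Set.Ioo (0 : ℝ) 1) :
    integralMean β r extremalFun = Real.circleAverage (fun z => ‖1 - z‖ ^ (6 * β)) 0 r := by
  rw [integralMean_eq_circleAverage]
  refine Real.circleAverage_congr_sphere fun z hz => ?_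
  have hz1 : z ∈ Metric.ball (0 : ℂ) 1 := by
    have : ‖z‖ = r := by simpa [abs_of_pos hr.1] using hz
    simpa [this] using hr.2
  simp only [deriv_extremalFun hz1]
  rw [norm_div, norm_pow, norm_one, one_div, one_div, Real.inv_rpow (by positivity), inv_inv,
    ← Real.rpow_natCast_mul (norm_nonneg _)]
  congr 1
  push_cast
  ring

/-- The exponent `6β` is positive, so `|1 - z|^(6β)` is continuous on the whole plane and its circle
averages depend continuously on `r`, including at `r = 1`. -/
theorem tendsto_integralMean_extremalFun {β : ℝ} (hβ : 0 < β) :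
    Tendsto (fun r : ℝ => integralMean β r extremalFun) (𝓝[<] 1) (𝓝 (sharpConst β)) := by
  have hc : Continuous fun z : ℂ => ‖1 - z‖ ^ (6 * β) :=
    Continuous.rpow_const (by fun_prop) fun _ => Or.inr (by positivity)
  have h := (Real.Continuous.circleAverage hc (c := 0)).tendsto 1
  rw [circleAverage_norm_one_sub_rpow hβ] at h
  refine (h.mono_left nhdsWithin_le_nhds).congr' ?_
  filter_upwards [Ioo_mem_nhdsLT (zero_lt_one' ℝ)] with r hr
  exact (integralMean_extremalFun hr).symm

/-! ### Herglotz representation of `log |h'|`. -/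

/-- The positive harmonic function `Re (1 + (2/3) z h''(z) / h'(z))` attached to `h ∈ classF`. -/
noncomputable def herglotzWeight (h : ℂ → ℂ) (z : ℂ) : ℝ :=
  (1 + 2 / 3 * (z * deriv (deriv h) z / deriv h z)).re

/-- The class condition reads `Re (z h''/h') > -3/2`, which explains the factor `2/3`. -/
theorem herglotzWeight_pos {h : ℂ → ℂ} (hh : h ∈ classF) {z : ℂ} (hz : z ∈ Metric.ball (0 : ℂ) 1) :
    0 < herglotzWeight h z := by
  have h1 := (hh.2 z hz).2
  have h2 : (2 / 3 * (z * deriv (deriv h) z / deriv h z) : ℂ) =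
    ((2 / 3 : ℝ) : ℂ) * (z * deriv (deriv h) z / deriv h z) := by push_cast; rfl
  rw [Complex.add_re, Complex.one_re] at h1
  rw [herglotzWeight, Complex.add_re, Complex.one_re, h2, Complex.re_ofReal_mul]
  linarith

theorem differentiableOn_herglotz {h : ℂ → ℂ} (hh : h ∈ classF) :
    DifferentiableOn ℂ (fun z => 1 + 2 / 3 * (z * deriv (deriv h) z / deriv h z))
      (Metric.ball 0 1) := by
  have h1 := hh.1.1.deriv.differentiableOn
  have h2 := hh.1.1.deriv.deriv.differentiableOn
  exact (((differentiableOn_id.mul h2).div h1 fun z hz => (hh.2 z hz).1).const_mul _).const_add 1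

theorem continuousOn_herglotzWeight {h : ℂ → ℂ} (hh : h ∈ classF) :
    ContinuousOn (herglotzWeight h) (Metric.ball 0 1) :=
  Complex.continuous_re.comp_continuousOn (differentiableOn_herglotz hh).continuousOn

theorem circleAverage_herglotzRieszKernel_mul_herglotzWeight {h : ℂ → ℂ} (hh : h ∈ classF) {R : ℝ}
    (hR1 : R < 1) {w : ℂ} (hw : ‖w‖ < R) :
    Real.circleAverage (fun z => (herglotzRieszKernel 0 w z).re * herglotzWeight h z) 0 R =
      herglotzWeight h w := by
  have hR : 0 < R := (norm_nonneg w).trans_lt hw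
  have hd : DiffContOnCl ℂ (fun z => 1 + 2 / 3 * (z * deriv (deriv h) z / deriv h z))
      (Metric.ball 0 R) := by
    refine DifferentiableOn.diffContOnCl ((differentiableOn_herglotz hh).mono ?_)
    rw [closure_ball _ hR.ne']
    exact Metric.closedBall_subset_ball hR1
  have hw' : w ∈ Metric.ball (0 : ℂ) R := by simpa using hw
  have h1 := hd.circleAverage_re_herglotzRieszKernel_smul hw'
  have hi : CircleIntegrable ((Complex.re ∘ herglotzRieszKernel 0 w) •
      fun z => 1 + 2 / 3 * (z * deriv (deriv h) z / deriv h z)) 0 R := by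
    refine ContinuousOn.circleIntegrable' (ContinuousOn.smul
      (Complex.continuous_re.comp_continuousOn (continuousOn_herglotzRieszKernel_sphere hw'))
      (hd.2.mono ?_))
    rw [abs_of_pos hR, closure_ball _ hR.ne']
    exact Metric.sphere_subset_closedBall
  have h2 := Complex.reCLM.circleAverage_comp_comm hi
  rw [h1] at h2
  refine Eq.trans ?_ h2
  congr 1
  ext z
  simp [herglotzWeight]
  ring

/-- Poisson's formula at the centre, where the kernel is identically 1. -/
theorem circleAverage_herglotzWeight {h : ℂ → ℂ} (hh : h ∈ classF) {R : ℝ}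
    (hR : 0 < R) (hR1 : R < 1) : Real.circleAverage (herglotzWeight h) 0 R = 1 := by
  have h1 := circleAverage_herglotzRieszKernel_mul_herglotzWeight hh hR1 (w := 0) (by simpa using hR)
  have h2 : herglotzWeight h 0 = 1 := by simp [herglotzWeight]
  rw [h2] at h1
  refine Eq.trans (Real.circleAverage_congr_sphere fun z hz => ?_) h1
  have hz0 : z ≠ 0 := by
    rintro rfl
    exact hR.ne (by simpa [abs_of_pos hR] using hz)
  simp [herglotzRieszKernel_def, hz0]

/-- The derivative along a ray of the Herglotz representation of `log |h'|`. -/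
theorem re_logDeriv_eq_circleAverage {h : ℂ → ℂ} (hh : h ∈ classF) {R : ℝ} (hR1 : R < 1) {z : ℂ}
    {t : ℝ} (ht : 0 < t) (hz : ‖t * z‖ < R) :
    (z * deriv (deriv h) (t * z) / deriv h (t * z)).re =
      -3 * Real.circleAverage (fun w => herglotzWeight h w * (-z / (w - t * z)).re) 0 R := by
  have hR : 0 < R := (norm_nonneg _).trans_lt hz
  have hball : Metric.sphere (0 : ℂ) |R| ⊆ Metric.ball 0 1 := by
    rw [abs_of_pos hR]
    exact Metric.sphere_subset_closedBall.trans (Metric.closedBall_subset_ball hR1)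
  have hρ := (continuousOn_herglotzWeight hh).mono hball
  have hne : ∀ w ∈ Metric.sphere (0 : ℂ) |R|, w - t * z ≠ 0 := by
    intro w hw h0
    have : ‖w‖ = R := by simpa [abs_of_pos hR] using hw
    rw [← sub_eq_zero.1 h0, this] at hz
    exact lt_irrefl _ hz
  have hk : ContinuousOn (fun w => herglotzWeight h w * (-z / (w - t * z)).re)
      (Metric.sphere 0 |R|) :=
    hρ.mul (Complex.continuous_re.comp_continuousOn (ContinuousOn.div (by fun_prop) (by fun_prop) hne))
  have h1 := circleAverage_herglotzRieszKernel_mul_herglotzWeight hh hR1 hz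
  have h2 : Real.circleAverage
      (fun w => (herglotzRieszKernel 0 (t * z) w).re * herglotzWeight h w) 0 R =
      Real.circleAverage (fun w => herglotzWeight h w +
        (-2 * t) • (herglotzWeight h w * (-z / (w - t * z)).re)) 0 R := by
    refine Real.circleAverage_congr_sphere fun w hw => ?_
    have h3 : herglotzRieszKernel 0 (t * z) w = 1 + ((-2 * t : ℝ) : ℂ) * (-z / (w - t * z)) := by
      have := hne w hw
      simp only [herglotzRieszKernel_def, sub_zero]
      push_cast
      field_simp
      ring
    simp only [h3, Complex.add_re, Complex.one_re, Complex.re_ofReal_mul, smul_eq_mul]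
    ring
  rw [h2, Real.circleAverage_fun_add hρ.circleIntegrable'
    (hk.fun_const_smul (-2 * t)).circleIntegrable', Real.circleAverage_fun_smul,
    circleAverage_herglotzWeight hh hR hR1, smul_eq_mul] at h1
  have h4 : herglotzWeight h (t * z) =
      1 + 2 / 3 * t * (z * deriv (deriv h) (t * z) / deriv h (t * z)).re := by
    have : (1 + 2 / 3 * (t * z * deriv (deriv h) (t * z) / deriv h (t * z)) : ℂ) =
        1 + ((2 / 3 * t : ℝ) : ℂ) * (z * deriv (deriv h) (t * z) / deriv h (t * z)) := by
      push_cast; ring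
    rw [herglotzWeight, this, Complex.add_re, Complex.one_re, Complex.re_ofReal_mul]
  rw [h4] at h1
  -- The Poisson formula yields only `t` times the claim, hence the assumption `0 < t`; the later
  -- integration over `t` does not see the endpoint 0.
  have h5 := mul_left_cancel₀ ht.ne' (show t * (z * deriv (deriv h) (t * z) / deriv h (t * z)).re =
    t * (-3 * Real.circleAverage (fun w => herglotzWeight h w * (-z / (w - t * z)).re) 0 R) by
      linarith)
  exact h5

/-- Integrate `re_logDeriv_eq_circleAverage` over `t` in `[0, 1]`. Both sides integrate logarithmic
derivatives, of `h'(t z)` (with `h'(0) = 1`) and of `w - t z`. -/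
theorem log_norm_deriv_eq_circleAverage {h : ℂ → ℂ} (hh : h ∈ classF) {R : ℝ} (hR1 : R < 1) {z : ℂ}
    (hz : ‖z‖ < R) :
    Real.log ‖deriv h z‖ =
      -3 * Real.circleAverage (fun w => herglotzWeight h w * Real.log ‖1 - z / w‖) 0 R := by
  have hR : 0 < R := (norm_nonneg _).trans_lt hz
  have hball : Metric.sphere (0 : ℂ) |R| ⊆ Metric.ball 0 1 := by
    rw [abs_of_pos hR]
    exact Metric.sphere_subset_closedBall.trans (Metric.closedBall_subset_ball hR1)
  have hρ := (continuousOn_herglotzWeight hh).mono hball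
  have htz : ∀ t ∈ Set.Icc (0 : ℝ) 1, ‖(t : ℂ) * z‖ < R := by
    intro t ht
    rw [norm_mul, Complex.norm_real, Real.norm_eq_abs, abs_of_nonneg ht.1]
    exact (mul_le_of_le_one_left (norm_nonneg z) ht.2).trans_lt hz
  have htz1 : ∀ t ∈ Set.Icc (0 : ℝ) 1, (t : ℂ) * z ∈ Metric.ball (0 : ℂ) 1 := fun t ht => by
    simpa using (htz t ht).trans hR1
  have hsphere : ∀ w ∈ Metric.sphere (0 : ℂ) |R|, ‖w‖ = R := fun w hw => by
    simpa [abs_of_pos hR] using hw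
  have hne : ∀ w ∈ Metric.sphere (0 : ℂ) |R|, ∀ t ∈ Set.Icc (0 : ℝ) 1, w - t * z ≠ 0 := by
    intro w hw t ht h0
    have := htz t ht
    rw [← sub_eq_zero.1 h0, hsphere w hw] at this
    exact lt_irrefl _ this
  have hleft : ∫ t in (0 : ℝ)..1, (z * deriv (deriv h) (t * z) / deriv h (t * z)).re =
      Real.log ‖deriv h z‖ := by
    have hd : ∀ t ∈ Set.Icc (0 : ℝ) 1,
        HasDerivAt (fun t : ℝ => deriv h (t * z)) (z * deriv (deriv h) (t * z)) t := by
      intro t ht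
      have h1 := (hh.1.1.deriv _ (htz1 t ht)).differentiableAt.hasDerivAt
      have h2 : HasDerivAt (fun t : ℝ => (t : ℂ) * z) z t := by
        simpa using (Complex.ofRealCLM.hasDerivAt (x := t)).mul_const z
      have h3 := HasDerivAt.comp_of_eq t h1 h2 rfl
      exact h3.congr_deriv (mul_comm _ _)
    rw [integral_re_div_eq_log_norm_sub zero_le_one hd (fun t ht => (hh.2 _ (htz1 t ht)).1)]
    · simp [hh.1.2.2]
    · exact continuousOn_const.mul (hh.1.1.deriv.deriv.continuousOn.comp
        (by fun_prop : Continuous fun t : ℝ => (t : ℂ) * z).continuousOn htz1)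
  have hright : ∀ w ∈ Metric.sphere (0 : ℂ) |R|,
      ∫ t in (0 : ℝ)..1, herglotzWeight h w * (-z / (w - t * z)).re =
        herglotzWeight h w * Real.log ‖1 - z / w‖ := by
    intro w hw
    have hw0 : w ≠ 0 := by
      intro h0
      have := hsphere w hw
      rw [h0, norm_zero] at this
      exact hR.ne this
    rw [intervalIntegral.integral_const_mul]
    have hd : ∀ t ∈ Set.Icc (0 : ℝ) 1, HasDerivAt (fun t : ℝ => w - t * z) (-z) t := by
      intro t _
      simpa using ((Complex.ofRealCLM.hasDerivAt (x := t)).mul_const z).const_sub w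
    rw [integral_re_div_eq_log_norm_sub zero_le_one hd (hne w hw) continuousOn_const]
    have h1 : w - z ≠ 0 := by simpa using hne w hw 1 (by simp)
    have h2 : 1 - z / w = (w - z) / w := by field_simp
    rw [h2, norm_div, Real.log_div (norm_ne_zero_iff.2 h1) (norm_ne_zero_iff.2 hw0)]
    simp
  rw [← Real.circleAverage_congr_sphere hright, circleAverage_intervalIntegral_swap zero_le_one,
    ← hleft, ← intervalIntegral.integral_const_mul]
  · refine intervalIntegral.integral_congr_ae (Eventually.of_forall fun t ht => ?_)
    rw [Set.uIoc_of_le zero_le_one] at ht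
    exact re_logDeriv_eq_circleAverage hh hR1 ht.1 (htz t ⟨ht.1.le, ht.2⟩)
  · refine ContinuousOn.mul (hρ.comp continuousOn_fst fun p hp => hp.1) ?_
    exact Complex.continuous_re.comp_continuousOn (ContinuousOn.div (by fun_prop) (by fun_prop)
      fun p hp => hne p.1 hp.1 p.2 hp.2)

/-! ### The sharp inequality. -/

theorem one_div_norm_deriv_rpow_le {h : ℂ → ℂ} (hh : h ∈ classF) (β : ℝ) {R : ℝ} (hR1 : R < 1)
    {z : ℂ} (hz : ‖z‖ < R) :
    1 / ‖deriv h z‖ ^ (2 * β) ≤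
      Real.circleAverage (fun w => herglotzWeight h w * ‖1 - z / w‖ ^ (6 * β)) 0 R := by
  have hR : 0 < R := (norm_nonneg _).trans_lt hz
  have hball : Metric.sphere (0 : ℂ) |R| ⊆ Metric.ball 0 1 := by
    rw [abs_of_pos hR]
    exact Metric.sphere_subset_closedBall.trans (Metric.closedBall_subset_ball hR1)
  have hρ := (continuousOn_herglotzWeight hh).mono hball
  have hsphere : ∀ w ∈ Metric.sphere (0 : ℂ) |R|, ‖w‖ = R := fun w hw => by
    simpa [abs_of_pos hR] using hw
  have hw0 : ∀ w ∈ Metric.sphere (0 : ℂ) |R|, w ≠ 0 := fun w hw =>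
    norm_ne_zero_iff.1 (by rw [hsphere w hw]; exact hR.ne')
  have hne : ∀ w ∈ Metric.sphere (0 : ℂ) |R|, 1 - z / w ≠ 0 := by
    intro w hw h0
    rw [sub_eq_zero, eq_comm, div_eq_one_iff_eq (hw0 w hw)] at h0
    rw [h0, hsphere w hw] at hz
    exact lt_irrefl _ hz
  -- Jensen is applied to this function; `6β = (-2β)(-3)`.
  have hg : ContinuousOn (fun w => 6 * β * Real.log ‖1 - z / w‖) (Metric.sphere 0 |R|) := by
    refine continuousOn_const.mul (ContinuousOn.log ?_ fun w hw => norm_ne_zero_iff.2 (hne w hw))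
    exact (continuousOn_const.sub (ContinuousOn.div (by fun_prop) (by fun_prop) hw0)).norm
  have h1 := exp_circleAverage_mul_le hρ hg (fun w hw => (herglotzWeight_pos hh (hball hw)).le)
    (circleAverage_herglotzWeight hh hR hR1)
  have h2 : Real.circleAverage
      (fun w => herglotzWeight h w * (6 * β * Real.log ‖1 - z / w‖)) 0 R =
      Real.log ‖deriv h z‖ * -(2 * β) := by
    have h3 := Real.circleAverage_fun_smul (a := 6 * β)
      (f := fun w => herglotzWeight h w * Real.log ‖1 - z / w‖) (c := 0) (R := R)
    rw [log_norm_deriv_eq_circleAverage hh hR1 hz]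
    simp only [smul_eq_mul, mul_left_comm (6 * β)] at h3
    rw [h3]
    ring
  have hpos : 0 < ‖deriv h z‖ := norm_pos_iff.2 (hh.2 z (by simpa using hz.trans hR1)).1
  rw [h2, ← Real.rpow_def_of_pos hpos, Real.rpow_neg hpos.le, ← one_div] at h1
  refine h1.trans_eq (Real.circleAverage_congr_sphere fun w hw => ?_)
  rw [Real.rpow_def_of_pos (norm_pos_iff.2 (hne w hw)), mul_comm (6 * β)]

theorem continuousOn_one_div_norm_deriv_rpow {h : ℂ → ℂ} (hh : h ∈ classF) (β : ℝ) :
    ContinuousOn (fun z => 1 / ‖deriv h z‖ ^ (2 * β)) (Metric.ball 0 1) := by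
  have hpos : ∀ z ∈ Metric.ball (0 : ℂ) 1, 0 < ‖deriv h z‖ := fun z hz =>
    norm_pos_iff.2 (hh.2 z hz).1
  exact ContinuousOn.div continuousOn_const
    (hh.1.1.deriv.continuousOn.norm.rpow_const fun z hz => Or.inl (hpos z hz).ne')
    fun z hz => (Real.rpow_pos_of_pos (hpos z hz) _).ne'

theorem integralMean_le_sharpConst {h : ℂ → ℂ} (hh : h ∈ classF) {β r : ℝ} (hβ : 0 < β)
    (hr : r ∈ Set.Ioo (0 : ℝ) 1) : integralMean β r h ≤ sharpConst β := by
  -- With `r < R < 1` the density is continuous on `|w| = R`, so no boundary measure on the unit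
  -- circle is needed.
  obtain ⟨R, hrR, hR1⟩ := exists_between hr.2
  have hr0 := hr.1
  have hR : 0 < R := hr0.trans hrR
  have hballr : Metric.sphere (0 : ℂ) |r| ⊆ Metric.ball 0 1 := by
    rw [abs_of_pos hr0]
    exact Metric.sphere_subset_closedBall.trans (Metric.closedBall_subset_ball hr.2)
  have hball : Metric.sphere (0 : ℂ) |R| ⊆ Metric.ball 0 1 := by
    rw [abs_of_pos hR]
    exact Metric.sphere_subset_closedBall.trans (Metric.closedBall_subset_ball hR1)
  have hρ := (continuousOn_herglotzWeight hh).mono hball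
  have hw0 : ∀ w ∈ Metric.sphere (0 : ℂ) |R|, w ≠ 0 := by
    rintro w hw rfl
    exact hR.ne (by simpa [abs_of_pos hR] using hw)
  have hF : ContinuousOn (Function.uncurry fun z w : ℂ =>
      herglotzWeight h w * ‖1 - z / w‖ ^ (6 * β))
      (Metric.sphere 0 |r| ×ˢ Metric.sphere 0 |R|) := by
    refine ContinuousOn.mul (hρ.comp continuousOn_snd fun p hp => hp.2) ?_
    refine ContinuousOn.rpow_const ?_ fun _ _ => Or.inr (by positivity)
    exact (continuousOn_const.sub
      (ContinuousOn.div (by fun_prop) (by fun_prop) fun p hp => hw0 p.2 hp.2)).norm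
  have hF' : ContinuousOn (Function.uncurry fun w z : ℂ =>
      herglotzWeight h w * ‖1 - z / w‖ ^ (6 * β))
      (Metric.sphere 0 |R| ×ˢ Metric.sphere 0 |r|) :=
    ContinuousOn.comp (f := Prod.swap) hF continuous_swap.continuousOn
      fun p hp => ⟨hp.2, hp.1⟩
  have hmean : ∀ w ∈ Metric.sphere (0 : ℂ) |R|,
      Real.circleAverage (fun z => herglotzWeight h w * ‖1 - z / w‖ ^ (6 * β)) 0 r ≤
        sharpConst β * herglotzWeight h w := by
    intro w hw
    have hwR : ‖w‖ = R := by simpa [abs_of_pos hR] using hw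
    have h1 : ‖(r : ℂ) / w‖ < 1 := by
      rw [norm_div, hwR, Complex.norm_real, Real.norm_eq_abs, abs_of_pos hr0, div_lt_one hR]
      exact hrR
    -- Writing `z = r ζ` with `|ζ| = 1` turns `1 - z / w` into `1 - a ζ`, where `a = r / w`.
    have h2 := circleAverage_norm_one_sub_mul_rpow_le (p := 6 * β) (by positivity) h1
    rw [circleAverage_norm_one_sub_rpow hβ] at h2
    have h3 := Real.circleAverage_fun_smul (a := herglotzWeight h w)
      (f := fun z => ‖1 - z / w‖ ^ (6 * β)) (c := 0) (R := r)
    simp only [smul_eq_mul] at h3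
    rw [h3, mul_comm, Real.circleAverage_eq_circleAverage_zero_one]
    refine mul_le_mul_of_nonneg_right ?_ (herglotzWeight_pos hh (hball hw)).le
    simpa [mul_div_right_comm] using h2
  rw [integralMean_eq_circleAverage]
  calc Real.circleAverage (fun z => 1 / ‖deriv h z‖ ^ (2 * β)) 0 r
      ≤ Real.circleAverage (fun z => Real.circleAverage
          (fun w => herglotzWeight h w * ‖1 - z / w‖ ^ (6 * β)) 0 R) 0 r := by
        refine Real.circleAverage_mono
          ((continuousOn_one_div_norm_deriv_rpow hh β).mono hballr).circleIntegrable'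
          (circleIntegrable_circleAverage hF) fun z hz => ?_
        refine one_div_norm_deriv_rpow_le hh β hR1 ?_
        have : ‖z‖ = r := by simpa [abs_of_pos hr0] using hz
        rwa [this]
    _ = Real.circleAverage (fun w => Real.circleAverage
          (fun z => herglotzWeight h w * ‖1 - z / w‖ ^ (6 * β)) 0 r) 0 R :=
        circleAverage_circleAverage_swap hF
    _ ≤ Real.circleAverage (fun w => sharpConst β • herglotzWeight h w) 0 R := by
        refine Real.circleAverage_mono (circleIntegrable_circleAverage hF')
          (hρ.fun_const_smul _).circleIntegrable' hmean
    _ = sharpConst β := by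
        rw [Real.circleAverage_fun_smul, circleAverage_herglotzWeight hh hR hR1, smul_eq_mul,
          mul_one]

theorem intervalIntegrable_meanIntegrand {h : ℂ → ℂ} (hh : h ∈ classF) {β r : ℝ}
    (hr : r ∈ Set.Ioo (0 : ℝ) 1) :
    IntervalIntegrable (meanIntegrand β r h) MeasureTheory.volume (-Real.pi) Real.pi := by
  have hc : Continuous fun θ : ℝ => (r : ℂ) * Complex.exp (θ * Complex.I) := by fun_prop
  refine Continuous.intervalIntegrable ?_ _ _
  refine (continuousOn_one_div_norm_deriv_rpow hh β).comp_continuous hc fun θ => ?_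
  simpa [Complex.norm_exp_ofReal_mul_I, abs_of_pos hr.1] using hr.2

theorem mainTheorem1 :
    -- the inequality, for every function of the class
    (∀ h ∈ classF, ∀ β : ℝ, 0 < β → ∀ r ∈ Set.Ioo (0 : ℝ) 1,
      IntervalIntegrable (meanIntegrand β r h) MeasureTheory.volume (-Real.pi) Real.pi ∧
      integralMean β r h ≤ sharpConst β) ∧
    -- sharpness: for every `β` the constant is the least upper bound of the integral means
    (∀ β : ℝ, 0 < β →
      IsLUB {I : ℝ | ∃ h ∈ classF, ∃ r ∈ Set.Ioo (0 : ℝ) 1, I = integralMean β r h}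
        (sharpConst β)) ∧
    -- it is approached, as `r → 1`, by the univalent function `h₀`, where `h₀' = (1 - z)⁻³`
    (extremalFun ∈ classF ∧ extremalFun ∈ classS ∧
      (∀ z ∈ Metric.ball (0 : ℂ) 1, deriv extremalFun z = 1 / (1 - z) ^ 3) ∧
      ∀ β : ℝ, 0 < β →
        Tendsto (fun r : ℝ => integralMean β r extremalFun) (𝓝[<] 1) (𝓝 (sharpConst β))) := by
  refine ⟨fun h hh β hβ r hr =>
      ⟨intervalIntegrable_meanIntegrand hh hr, integralMean_le_sharpConst hh hβ hr⟩,
    fun β hβ => ⟨?_, fun b hb => ?_⟩,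
    extremalFun_mem_classF, extremalFun_mem_classS, fun z hz => deriv_extremalFun hz,
    fun β hβ => tendsto_integralMean_extremalFun hβ⟩
  · rintro _ ⟨h, hh, r, hr, rfl⟩
    exact integralMean_le_sharpConst hh hβ hr
  · refine le_of_tendsto (tendsto_integralMean_extremalFun hβ) ?_
    filter_upwards [Ioo_mem_nhdsLT (zero_lt_one' ℝ)] with r hr
    exact hb ⟨extremalFun, extremalFun_mem_classF, r, hr, rfl⟩
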